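/- Let $F$ be a finite field with $q$ elements and let $E/F$ be a finite extension of degree $n\ge 1$ (so $|E|=q^n$); let $p$ be the characteristic. For $d\mid n$ let $\mathbb F_{q^d}$ denote the intermediate field of $E/F$ of degree $d$ over $F$. An element $w\in E$ is *primitive* if it generates $E^*$; it is *normal* over an intermediate field $K$ with $|K|=Q$ and $m=[E:K]$ if $w,w^{Q},\dots,w^{Q^{m-1}}$ is a $K$-basis of $E$; it is *completely normal* over $F$ if it is normal over every intermediate field $K$ of $E/F$. Let $CN_n(q)$ be the number of completely normal elements of $E$ over $F$, and $PCN_n(q)$ the number of those that are moreover primitive. A set $\mathcal D$ of positive divisors of $n$ is *$(q,n)$-essential* if every $w\in E$ is completely normal over $F$ if and only if $w$ is normal over $\mathbb F_{q^d}$ for every $d\in\mathcal D$. Let $\omega$ be the number of distinct prime divisors of $q^n-1$. For a positive integer $m$ let $\phi_{q^d}(x^m-1)$ be the number of units of $\mathbb F_{q^d}[x]/(x^m-1)$, and let $m'$ be the largest divisor of $m$ that is not divisible by $p$. For $d\mid n$ let $\Omega_d$ be the number of distinct monic divisors of $x^{n/d}-1$ that are irreducible over $\mathbb F_{q^d}$,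 and let $$\Theta_d=\frac{\phi_{q^d}\big(x^{(n/d)'}-1\big)}{q^{d\,(n/d)'}}.$$ For a $(q,n)$-essential set $\mathcal D$ put (with $\mu$ the Möbius function) $$U=\sum_{d\in\mathcal D}\Big(\sum_{a\mid \frac nd}\mu\big(\tfrac{n}{da}\big)q^{da}-\phi_{q^d}\big(x^{n/d}-1\big)\Big).$$ Then, for every $(q,n)$-essential set $\mathcal D$: 1. If $CN_n(q)>q^{n/2}\,(2^\omega-1)\prod_{d\in\mathcal D}\big(\Theta_d\,2^{\Omega_d}\big)$, then $PCN_n(q)>0$. 2. One has $\Theta_d<1$ for every $d\in\mathcal D$; and if $q^n-U\ge q^{n/2}\cdot 2^\omega\cdot 2^{\sum_{d\in\mathcal D}\Omega_d}$, then $PCN_n(q)>0$. 3. One has $2^\omega\le 4514.7\cdot q^{n/8}$; and if $q^n-U\ge 4514.7\cdot q^{5n/8}\cdot 2^{\sum_{d\in\mathcal D}\Omega_d}$, then $PCN_n(q)>0$. -/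

import Mathlib

open Polynomial

noncomputable section

/-- The intermediate field of `E/F` with `|F| ^ d` elements (for `d` dividing the degree of `E/F`),
consisting of the elements `x` of `E` with `x ^ (|F| ^ d) = x`. -/
def subfieldOfDegree (F E : Type*) [Field F] [Finite F] [Field E] [Algebra F E] (d : ℕ) :
    IntermediateField F E where
  carrier := {x : E | x ^ (Nat.card F ^ d) = x}
  mul_mem' := by
    intro a b ha hb
    simp only [Set.mem_ofPred_eq] at ha hb ⊢
    rw [mul_pow, ha, hb]
  add_mem' := by
    intro a b ha hb
    simp only [Set.mem_ofPred_eq] at ha hb ⊢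
    have := Fintype.ofFinite F
    obtain ⟨k, hp, hk⟩ := FiniteField.card F (ringChar F)
    have : Fact (ringChar F).Prime := ⟨hp⟩
    have : CharP E (ringChar F) := charP_of_injective_algebraMap (algebraMap F E).injective _
    rw [Nat.card_eq_fintype_card, hk, ← pow_mul] at ha hb ⊢
    rw [add_pow_char_pow, ha, hb]
  algebraMap_mem' := by
    intro a
    have := Fintype.ofFinite F
    simp only [Set.mem_ofPred_eq]
    rw [← map_pow, Nat.card_eq_fintype_card, FiniteField.pow_card_pow]
  inv_mem' := by
    intro a ha
    simp only [Set.mem_ofPred_eq] at ha ⊢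
    rw [inv_pow, ha]

/-- `w` is a primitive element of the field `E`: it generates the multiplicative group of `E`. -/
def IsPrimitiveElement {E : Type*} [Field E] (w : E) : Prop :=
  ∃ u : Eˣ, (u : E) = w ∧ ∀ v : Eˣ, v ∈ Subgroup.zpowers u

/-- For an extension `E/K` of finite fields with `|K| = Q` and degree `m`, the element `w` of `E`
is normal over `K`: its conjugates `w, w ^ Q, …, w ^ (Q ^ (m - 1))` are a `K`-basis of `E`. -/
def IsNormalElement (K : Type*) {E : Type*} [Field K] [Field E] [Algebra K E] (w : E) : Prop :=
  LinearIndependent K (fun i : Fin (Module.finrank K E) => w ^ (Nat.card K ^ (i : ℕ))) ∧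
    Submodule.span K
      (Set.range (fun i : Fin (Module.finrank K E) => w ^ (Nat.card K ^ (i : ℕ)))) = ⊤

/-- `w` is completely normal over `F`: normal over every intermediate field of `E/F`. -/
def IsCompletelyNormal (F : Type*) {E : Type*} [Field F] [Field E] [Algebra F E] (w : E) : Prop :=
  ∀ K : IntermediateField F E, IsNormalElement K w

/-- The number of completely normal elements of `E` over `F`. -/
def numCN (F E : Type*) [Field F] [Field E] [Algebra F E] : ℕ :=
  Nat.card {w : E // IsCompletelyNormal F w}

/-- The number of primitive completely normal elements of `E` over `F`. -/
def numPCN (F E : Type*) [Field F] [Field E] [Algebra F E] : ℕ :=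
  Nat.card {w : E // IsPrimitiveElement w ∧ IsCompletelyNormal F w}

/-- A set `D` of divisors of the degree of `E/F` is `E/F`-essential if an element of `E` is
completely normal over `F` exactly when it is normal over the intermediate field of degree `d`
over `F` for every `d ∈ D`. -/
def IsEssential (F E : Type*) [Field F] [Finite F] [Field E] [Algebra F E] (D : Finset ℕ) : Prop :=
  (∀ d ∈ D, d ∣ Module.finrank F E) ∧
    ∀ w : E, IsCompletelyNormal F w ↔ ∀ d ∈ D, IsNormalElement (subfieldOfDegree F E d) w

/-- The number of units of the residue ring `K[x]/(x ^ m - 1)`. -/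
def polyPhi (K : Type*) [Field K] (m : ℕ) : ℕ :=
  Nat.card (K[X] ⧸ Ideal.span {(X ^ m - 1 : K[X])})ˣ

/-- The number of distinct monic irreducible divisors of `x ^ m - 1` over `K`. -/
def numIrredDivisors (K : Type*) [Field K] (m : ℕ) : ℕ :=
  Nat.card {f : K[X] // f.Monic ∧ Irreducible f ∧ f ∣ X ^ m - 1}

/-- With `n` the degree of `E/F`: the number of distinct monic divisors of `x ^ (n / d) - 1` that
are irreducible over the intermediate field of degree `d`. -/
def bigOmega (F E : Type*) [Field F] [Finite F] [Field E] [Algebra F E] (d : ℕ) : ℕ :=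
  numIrredDivisors (subfieldOfDegree F E d) (Module.finrank F E / d)

/-- With `q = |F|`, `n` the degree of `E/F`, `p` the characteristic, and `m` the `p`-free part of
`n / d`: the quotient of the number of units of `F_{q ^ d}[x]/(x ^ m - 1)` by `q ^ (d * m)`. -/
def bigTheta (F E : Type*) [Field F] [Finite F] [Field E] [Algebra F E] (d : ℕ) : ℝ :=
  (polyPhi (subfieldOfDegree F E d) (ordCompl[ringChar F] (Module.finrank F E / d)) : ℝ) /
    (Nat.card F : ℝ) ^ (d * ordCompl[ringChar F] (Module.finrank F E / d))

/-- With `q = |F|` and `n` the degree of `E/F`: the sum over `d ∈ D` of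
`(∑_{a ∣ n/d} μ(n/(d a)) q ^ (d a)) - φ_{q ^ d}(x ^ (n/d) - 1)`. -/
def boundU (F E : Type*) [Field F] [Finite F] [Field E] [Algebra F E] (D : Finset ℕ) : ℤ :=
  ∑ d ∈ D,
    ((∑ a ∈ (Module.finrank F E / d).divisors,
        ArithmeticFunction.moebius (Module.finrank F E / (d * a)) * (Nat.card F : ℤ) ^ (d * a)) -
      (polyPhi (subfieldOfDegree F E d) (Module.finrank F E / d) : ℤ))

end

/-! The primitive elements and the completely normal elements are both cut out by avoiding
subgroups, and such indicators have Fourier coefficients of small absolute sum. For a subgroup of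
index k, the indicator of the complement has trivial coefficient 1 - 1/k and k - 1 coefficients
-1/k, of total 2(1 - 1/k); under products these totals at most multiply. In E^*, primitive means
outside the r-th powers for every prime r dividing q^n - 1: the mean is θ = φ(q^n - 1)/(q^n - 1) and
the total at most θ 2^ω. In (E, +), a Frobenius module isomorphic to F_{q^d}[x]/(x^{n/d} - 1),
normality over F_{q^d} means avoiding one subgroup of index q^{d deg P} for each irreducible P
dividing x^{n/d} - 1: the total is at most Θ_d 2^{Ω_d}.

Expand PCN by both kinds of characters. The trivial multiplicative character contributes exactly θ
CN; the others produce Gauss sums of modulus at most q^{n/2}. Hence |PCN - θ CN| ≤ θ (2^ω - 1)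
q^{n/2} ∏ Θ_d 2^{Ω_d} (`norm_sum_primitive_mul_sub_le`, `hasWienerBound_isCompletelyNormal`), and
PCN = 0 contradicts the hypothesis of part 1.

For part 2, an element that is not completely normal lies in a proper intermediate field or, for
some d in D, has full degree over F_{q^d} without being normal there; so q^n - CN < U + 2 q^{n/2}
(`card_sub_numCN_le`, `natCard_minimalPeriod_ne_lt`). The gap between 2^ω and 2^ω - 1 pays for 2
q^{n/2}. Part 3 inserts an elementary bound for 2^ω. -/

noncomputable section

/-! ### Absolute sums of Fourier coefficients on finite abelian groups. -/

section Fourier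

variable {A : Type*} [AddCommGroup A] [Fintype A]

/-- `f` is a combination of characters whose coefficients have absolute values of sum at most
`C`. -/
def HasWienerBound (f : A → ℂ) (C : ℝ) : Prop :=
  ∃ c : AddChar A ℂ → ℂ, (∀ a, f a = ∑ ψ, c ψ * ψ a) ∧ ∑ ψ, ‖c ψ‖ ≤ C

/-- Coefficients belonging to the same character are collected, and the triangle inequality only
lowers the sum. Thus products and pullbacks of characters need no injectivity check. -/
lemma HasWienerBound.of_family {ι : Type*} [Fintype ι] (b : ι → ℂ) (ψ : ι → AddChar A ℂ) :
    HasWienerBound (fun a => ∑ i, b i * ψ i a) (∑ i, ‖b i‖) := by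
  classical
  refine ⟨fun φ => ∑ i, if ψ i = φ then b i else 0, fun a => ?_, ?_⟩
  · simp_rw [Finset.sum_mul]
    rw [Finset.sum_comm]
    refine Finset.sum_congr rfl fun i _ => ?_
    simp [ite_mul]
  · calc _ ≤ ∑ φ, ∑ i, ‖if ψ i = φ then b i else 0‖ :=
          Finset.sum_le_sum fun φ _ => norm_sum_le _ _
      _ = ∑ i, ‖b i‖ := by
          rw [Finset.sum_comm]
          refine Finset.sum_congr rfl fun i _ => ?_
          simp [apply_ite norm]
      _ ≤ _ := le_rfl

lemma HasWienerBound.congr {f g : A → ℂ} {C : ℝ} (hf : HasWienerBound f C) (h : ∀ a, f a = g a) :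
    HasWienerBound g C :=
  (funext h : f = g) ▸ hf

lemma HasWienerBound.one : HasWienerBound (1 : A → ℂ) 1 := by
  simpa using! HasWienerBound.of_family (A := A) (fun _ : Unit => 1) (fun _ => 1)

lemma HasWienerBound.mul {f g : A → ℂ} {C C' : ℝ} (hf : HasWienerBound f C)
    (hg : HasWienerBound g C') : HasWienerBound (f * g) (C * C') := by
  obtain ⟨c, hc, hC⟩ := hf
  obtain ⟨c', hc', hC'⟩ := hg
  obtain ⟨b, hb, hB⟩ := HasWienerBound.of_family (A := A)
    (fun p : AddChar A ℂ × AddChar A ℂ => c p.1 * c' p.2) (fun p => p.1 * p.2)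
  refine ⟨b, fun a => ?_, hB.trans ?_⟩
  · rw [← hb, Pi.mul_apply, hc, hc', Finset.sum_mul_sum]
    simp only [Fintype.sum_prod_type]
    refine Finset.sum_congr rfl fun ψ _ => Finset.sum_congr rfl fun φ _ => ?_
    rw [AddChar.mul_apply]; ring
  · simp_rw [norm_mul]
    simp only [Fintype.sum_prod_type]
    rw [← Finset.sum_mul_sum]
    exact mul_le_mul hC hC' (Finset.sum_nonneg fun _ _ => norm_nonneg _)
      ((Finset.sum_nonneg fun _ _ => norm_nonneg _).trans hC)

lemma HasWienerBound.prod {ι : Type*} (s : Finset ι) {f : ι → A → ℂ} {C : ι → ℝ}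
    (h : ∀ i ∈ s, HasWienerBound (f i) (C i)) :
    HasWienerBound (∏ i ∈ s, f i) (∏ i ∈ s, C i) := by
  classical
  induction s using Finset.induction_on with
  | empty => simpa using HasWienerBound.one
  | insert i s hi ih =>
    rw [Finset.prod_insert hi, Finset.prod_insert hi]
    exact (h i (Finset.mem_insert_self i s)).mul
      (ih fun j hj => h j (Finset.mem_insert_of_mem hj))

/-- A bound uniform over all characters, the trivial one included, transfers to `f` by expanding `f`
and exchanging the sums. -/
lemma HasWienerBound.norm_sum_mul_le {f : A → ℂ} {C B : ℝ} (hf : HasWienerBound f C)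
    (F : A → ℂ) (hF : ∀ ψ : AddChar A ℂ, ‖∑ a, F a * ψ a‖ ≤ B) :
    ‖∑ a, F a * f a‖ ≤ B * C := by
  obtain ⟨c, hc, hC⟩ := hf
  have hB : 0 ≤ B := (norm_nonneg _).trans (hF 1)
  have : ∑ a, F a * f a = ∑ ψ, c ψ * ∑ a, F a * ψ a := by
    simp_rw [hc, Finset.mul_sum]
    rw [Finset.sum_comm]
    exact Finset.sum_congr rfl fun ψ _ => Finset.sum_congr rfl fun a _ => by ring
  rw [this]
  calc _ ≤ ∑ ψ, ‖c ψ‖ * B := (norm_sum_le _ _).trans <| Finset.sum_le_sum fun ψ _ => by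
          rw [norm_mul]; exact mul_le_mul_of_nonneg_left (hF ψ) (norm_nonneg _)
    _ = B * ∑ ψ, ‖c ψ‖ := by rw [← Finset.sum_mul, mul_comm]
    _ ≤ _ := mul_le_mul_of_nonneg_left hC hB

open Classical in
/-- The complement of a subgroup of index `k` has Wiener bound `2 (1 - 1 / k)`. -/
lemma HasWienerBound.compl_addSubgroup (H : AddSubgroup A) :
    HasWienerBound (fun a => if a ∈ H then 0 else 1) (2 * (1 - (H.index : ℝ)⁻¹)) := by
  have : Fintype (A ⧸ H) := Fintype.ofFinite _
  have hk : Fintype.card (A ⧸ H) = H.index := by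
    rw [AddSubgroup.index, Nat.card_eq_fintype_card]
  have hk0 : (H.index : ℝ) ≠ 0 := Nat.cast_ne_zero.2 AddSubgroup.index_ne_zero_of_finite
  have hk0' : (H.index : ℂ) ≠ 0 := Nat.cast_ne_zero.2 AddSubgroup.index_ne_zero_of_finite
  have hk1 : (1 : ℝ) ≤ H.index := Nat.one_le_cast.2 (Nat.pos_of_ne_zero
    AddSubgroup.index_ne_zero_of_finite)
  -- By orthogonality on `A ⧸ H`, the indicator of `H` is 1/k times the sum of all characters
  -- trivial on `H`; `b` lists the coefficients of its complement.
  let b : AddChar (A ⧸ H) ℂ → ℂ := fun χ => (if χ = 0 then 1 else 0) - (H.index : ℂ)⁻¹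
  have key := HasWienerBound.of_family (A := A) b
    (fun χ => χ.compAddMonoidHom (QuotientAddGroup.mk' H))
  have hsum : ∑ χ, ‖b χ‖ = 2 * (1 - (H.index : ℝ)⁻¹) := by
    rw [← Finset.add_sum_erase _ _ (Finset.mem_univ (0 : AddChar (A ⧸ H) ℂ))]
    have h0 : ‖b 0‖ = 1 - (H.index : ℝ)⁻¹ := by
      have : b 0 = ((1 - (H.index : ℝ)⁻¹ : ℝ) : ℂ) := by simp [b]
      rw [this, Complex.norm_real, Real.norm_of_nonneg]
      exact sub_nonneg.2 (inv_le_one_of_one_le₀ hk1)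
    have h1 : ∀ χ ∈ (Finset.univ : Finset (AddChar (A ⧸ H) ℂ)).erase 0,
        ‖b χ‖ = (H.index : ℝ)⁻¹ := by
      intro χ hχ
      simp [b, Finset.ne_of_mem_erase hχ]
    rw [Finset.sum_congr rfl h1, h0, Finset.sum_const, Finset.card_erase_of_mem (Finset.mem_univ _),
      Finset.card_univ, AddChar.card_eq, hk, nsmul_eq_mul, Nat.cast_sub (by exact_mod_cast hk1)]
    field_simp
    push_cast; ring
  rw [hsum] at key
  refine key.congr fun a => ?_
  simp only [b, sub_mul, Finset.sum_sub_distrib, AddChar.compAddMonoidHom_apply,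
    QuotientAddGroup.mk'_apply, ← Finset.mul_sum, ite_mul, one_mul, zero_mul,
    Finset.sum_ite_eq', Finset.mem_univ, if_true, AddChar.sum_apply_eq_ite, hk, AddChar.zero_apply,
    QuotientAddGroup.eq_zero_iff]
  by_cases h : a ∈ H <;> simp [h, hk0']

/-- The coefficient of the trivial character is the mean value. -/
lemma sum_eq_card_mul_coeff {f : A → ℂ} {c : AddChar A ℂ → ℂ} (h : ∀ a, f a = ∑ ψ, c ψ * ψ a) :
    ∑ a, f a = Fintype.card A * c 0 := by
  classical
  simp_rw [h]
  rw [Finset.sum_comm]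
  simp_rw [← Finset.mul_sum, AddChar.sum_eq_ite]
  simp [mul_comm]

end Fourier

/-! ### Gauss sums and characters of the unit group. -/

section GaussSum

variable {E : Type*} [Field E]

/-- For nontrivial `ψ` the product of the sum with its conjugate is |E|; for trivial `ψ` the sum
vanishes. The inequality covers both cases. -/
lemma norm_gaussSum_le [Fintype E] {χ : MulChar E ℂ} (hχ : χ ≠ 1) (ψ : AddChar E ℂ) :
    ‖gaussSum χ ψ‖ ≤ √(Fintype.card E) := by
  by_cases hψ : ψ = 1
  · rw [hψ, gaussSum_one_right hχ]; simp
  have h := gaussSum_mul_gaussSum_eq_card hχ (AddChar.IsPrimitive.of_ne_one hψ)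
  rw [← star_gaussSum_eq] at h
  apply Real.le_sqrt_of_sq_le
  have h' := congrArg norm h
  rw [norm_mul, norm_star, Complex.norm_natCast] at h'
  rw [sq, h']

/-- The multiplicative character attached to a character of the group of units. -/
def unitsAddCharToMulChar (χ : AddChar (Additive Eˣ) ℂ) : MulChar E ℂ :=
  MulChar.ofUnitHom (MonoidHom.toHomUnits
    { toFun := fun u : Eˣ => χ (Additive.ofMul u)
      map_one' := χ.map_zero_eq_one
      map_mul' := fun u v => χ.map_add_eq_mul (Additive.ofMul u) (Additive.ofMul v) })

lemma unitsAddCharToMulChar_apply (χ : AddChar (Additive Eˣ) ℂ) (u : Eˣ) :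
    unitsAddCharToMulChar χ (u : E) = χ (Additive.ofMul u) := by
  simp [unitsAddCharToMulChar]

lemma unitsAddCharToMulChar_ne_one {χ : AddChar (Additive Eˣ) ℂ} (hχ : χ ≠ 0) :
    unitsAddCharToMulChar χ ≠ 1 := by
  intro h
  apply hχ
  ext u
  have := unitsAddCharToMulChar_apply χ u.toMul
  rw [h, MulChar.one_apply_coe] at this
  exact this.symm

end GaussSum

/-! ### Primitive elements and multiplicative characters. -/

section Primitive

lemma isPrimitiveElement_iff_orderOf {E : Type*} [Field E] [Finite E] (u : Eˣ) :
    IsPrimitiveElement (u : E) ↔ orderOf u = Nat.card Eˣ := by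
  constructor
  · rintro ⟨v, hv, h⟩
    rw [Units.ext hv] at h
    exact orderOf_eq_card_of_forall_mem_zpowers h
  · intro h
    refine ⟨u, rfl, fun v => ?_⟩
    rw [(Subgroup.card_eq_iff_eq_top _).1 ((Nat.card_zpowers u).trans h)]
    exact Subgroup.mem_top v

/-- An r-th power is killed by N/r, where N is the group order. Conversely g^k, for a generator g,
has order N/gcd(N, k), and a prime r dividing this gcd makes g^k an r-th power. -/
lemma orderOf_eq_card_iff_forall_notMem_range_pow {G : Type*} [CommGroup G] [Finite G] [IsCyclic G]
    (u : G) : orderOf u = Nat.card G ↔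
      ∀ r ∈ (Nat.card G).primeFactors, u ∉ (powMonoidHom r : G →* G).range := by
  constructor
  · rintro h r hr ⟨v, hv⟩
    have hr' := Nat.prime_of_mem_primeFactors hr
    have hd := Nat.dvd_of_mem_primeFactors hr
    have h1 : u ^ (Nat.card G / r) = 1 := by
      rw [← hv, powMonoidHom_apply, ← pow_mul, Nat.mul_div_cancel' hd, pow_card_eq_one']
    have h2 := Nat.le_of_dvd (Nat.div_pos (Nat.le_of_dvd Nat.card_pos hd) hr'.pos)
      (orderOf_dvd_of_pow_eq_one h1)
    rw [h] at h2
    exact absurd (Nat.div_lt_self Nat.card_pos hr'.one_lt) (not_lt.2 h2)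
  · intro h
    obtain ⟨g, hg⟩ := IsCyclic.exists_generator (α := G)
    obtain ⟨k, rfl⟩ := (mem_powers_iff_mem_zpowers (x := g)).2 (hg u)
    have hg' := orderOf_eq_card_of_forall_mem_zpowers hg
    dsimp only at *
    rw [orderOf_pow, hg']
    suffices hk : (Nat.card G).gcd k = 1 by rw [hk, Nat.div_one]
    by_contra hk
    obtain ⟨r, hr, hrd⟩ := Nat.exists_prime_and_dvd hk
    refine h r (Nat.mem_primeFactors.2 ⟨hr, hrd.trans (Nat.gcd_dvd_left _ _), Nat.card_pos.ne'⟩) ?_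
    obtain ⟨j, hj⟩ := hrd.trans (Nat.gcd_dvd_right _ _)
    exact ⟨g ^ j, by rw [powMonoidHom_apply, ← pow_mul, hj, mul_comm]⟩

variable {E : Type*} [Field E]

/-- The proportion of primitive elements among the nonzero elements. -/
def primitiveDensity (E : Type*) [Field E] : ℝ :=
  ∏ r ∈ (Nat.card Eˣ).primeFactors, (1 - (r : ℝ)⁻¹)

lemma primitiveDensity_pos : 0 < primitiveDensity E := by
  refine Finset.prod_pos fun r hr => sub_pos.2 (inv_lt_one_of_one_lt₀ ?_)
  exact_mod_cast (Nat.prime_of_mem_primeFactors hr).one_lt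

variable [Fintype E]

open Classical in
-- In a cyclic group of order N the r-th powers have index r for each prime r dividing N; the bounds
-- for the complements multiply.
lemma hasWienerBound_primitive :
    HasWienerBound (fun u : Additive Eˣ => if IsPrimitiveElement (u.toMul : E) then 1 else 0)
      (primitiveDensity E * 2 ^ (Nat.card Eˣ).primeFactors.card) := by
  have h := HasWienerBound.prod (A := Additive Eˣ) (Nat.card Eˣ).primeFactors
    (fun r hr => HasWienerBound.compl_addSubgroup
      ((powMonoidHom r : Eˣ →* Eˣ).range.toAddSubgroup))
  rw [Finset.prod_mul_distrib, Finset.prod_const, mul_comm] at h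
  have hi : ∀ r ∈ (Nat.card Eˣ).primeFactors,
      ((powMonoidHom r : Eˣ →* Eˣ).range.toAddSubgroup).index = r := by
    intro r hr
    rw [Subgroup.index_toAddSubgroup, IsCyclic.index_powMonoidHom_range,
      Nat.gcd_eq_right (Nat.dvd_of_mem_primeFactors hr)]
  have hp : ∏ r ∈ (Nat.card Eˣ).primeFactors,
      (1 - (((powMonoidHom r : Eˣ →* Eˣ).range.toAddSubgroup).index : ℝ)⁻¹) =
        primitiveDensity E :=
    Finset.prod_congr rfl fun r hr => by rw [hi r hr]
  rw [hp] at h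
  refine h.congr fun u => ?_
  rw [Finset.prod_apply, isPrimitiveElement_iff_orderOf,
    orderOf_eq_card_iff_forall_notMem_range_pow]
  split_ifs with hu
  · exact Finset.prod_eq_one fun r hr => if_neg (hu r hr)
  · push Not at hu
    obtain ⟨r, hr, hu⟩ := hu
    exact Finset.prod_eq_zero hr (if_pos hu)

open Classical in
lemma sum_primitive :
    ∑ u : Additive Eˣ, (if IsPrimitiveElement (u.toMul : E) then (1 : ℂ) else 0) =
      Fintype.card (Additive Eˣ) * (primitiveDensity E : ℂ) := by
  have h1 : ∑ u : Additive Eˣ, (if IsPrimitiveElement (u.toMul : E) then (1 : ℂ) else 0) =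
      (Finset.univ.filter fun u : Eˣ => orderOf u = Nat.card Eˣ).card := by
    rw [← Finset.sum_boole]
    exact Fintype.sum_equiv Additive.toMul _ _ fun u => by
      simp only [isPrimitiveElement_iff_orderOf]
  have h2 : Fintype.card (Additive Eˣ) = Nat.card Eˣ := by
    rw [Nat.card_eq_fintype_card]; exact Fintype.card_congr Additive.toMul
  rw [h1, h2, IsCyclic.card_orderOf_eq_totient (by rw [Nat.card_eq_fintype_card]),
    primitiveDensity]
  have := Nat.totient_eq_mul_prod_factors (Nat.card Eˣ)
  have := congrArg (fun x : ℚ => (x : ℂ)) this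
  push_cast at this ⊢
  exact this

open Classical in
/-- The weighted sum over primitive elements of a function with small Fourier coefficients. -/
lemma norm_sum_primitive_mul_sub_le {g : E → ℂ} {C : ℝ} (hC : HasWienerBound g C) :
    ‖∑ u : Eˣ, (if IsPrimitiveElement (u : E) then 1 else 0) * g u -
        primitiveDensity E * ∑ u : Eˣ, g u‖ ≤
      primitiveDensity E * (2 ^ (Nat.card Eˣ).primeFactors.card - 1) *
        (√(Fintype.card E) * C) := by
  obtain ⟨c, hc, hcs⟩ := hasWienerBound_primitive (E := E)
  have h0 : c 0 = primitiveDensity E := by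
    have h := sum_eq_card_mul_coeff hc
    rw [sum_primitive] at h
    exact (mul_left_cancel₀ (Nat.cast_ne_zero.2 Fintype.card_ne_zero) h).symm
  -- Extended by zero to E, `χ` is a multiplicative character, so the additive expansion of `g`
  -- yields Gauss sums.
  have hχ : ∀ χ : AddChar (Additive Eˣ) ℂ, χ ≠ 0 →
      ‖∑ u : Eˣ, χ (Additive.ofMul u) * g u‖ ≤ √(Fintype.card E) * C := by
    intro χ hχ
    have : ∑ u : Eˣ, χ (Additive.ofMul u) * g u =
        ∑ a : E, unitsAddCharToMulChar χ a * g a := by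
      rw [← Finset.sum_subset (Finset.subset_univ
        (Finset.univ.map ⟨((↑) : Eˣ → E), Units.val_injective⟩))]
      · simp [unitsAddCharToMulChar_apply]
      · intro a _ ha
        rw [MulChar.map_nonunit, zero_mul]
        rintro ⟨u, rfl⟩
        exact ha (Finset.mem_map_of_mem _ (Finset.mem_univ u))
    rw [this]
    exact hC.norm_sum_mul_le _ fun ψ => norm_gaussSum_le (unitsAddCharToMulChar_ne_one hχ) ψ
  have hexp : ∑ u : Eˣ, (if IsPrimitiveElement (u : E) then 1 else 0) * g u =
      ∑ χ, c χ * ∑ u : Eˣ, χ (Additive.ofMul u) * g u := by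
    simp_rw [Finset.mul_sum]
    rw [Finset.sum_comm]
    refine Finset.sum_congr rfl fun u _ => ?_
    rw [show (if IsPrimitiveElement (u : E) then (1 : ℂ) else 0) = _ from hc (Additive.ofMul u),
      Finset.sum_mul]
    exact Finset.sum_congr rfl fun χ _ => by ring
  rw [hexp, ← Finset.add_sum_erase _ _ (Finset.mem_univ (0 : AddChar (Additive Eˣ) ℂ)), h0]
  simp only [AddChar.zero_apply, one_mul, add_sub_cancel_left]
  -- The trivial coefficient is the density itself; removing it from the total turns 2^ω into 2^ω -
  -- 1.
  have hce : ∑ χ ∈ Finset.univ.erase (0 : AddChar (Additive Eˣ) ℂ), ‖c χ‖ ≤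
      primitiveDensity E * (2 ^ (Nat.card Eˣ).primeFactors.card - 1) := by
    rw [← Finset.add_sum_erase _ _ (Finset.mem_univ (0 : AddChar (Additive Eˣ) ℂ)), h0,
      Complex.norm_real, Real.norm_of_nonneg primitiveDensity_pos.le] at hcs
    linarith
  have hnn : 0 ≤ √(Fintype.card E) * C := by
    obtain ⟨b, -, hb⟩ := hC
    exact mul_nonneg (Real.sqrt_nonneg _)
      ((Finset.sum_nonneg fun _ _ => norm_nonneg _).trans hb)
  refine ((norm_sum_le _ _).trans (Finset.sum_le_sum fun χ h => ?_)).trans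
    ((Finset.sum_mul _ _ _).symm.le.trans (mul_le_mul_of_nonneg_right hce hnn))
  rw [norm_mul]
  exact mul_le_mul_of_nonneg_left (hχ χ (Finset.ne_of_mem_erase h)) (norm_nonneg _)

end Primitive

/-! ### Normal elements as generators of E as a Frobenius module. -/

section Normal

variable (K : Type*) {E : Type*} [Field K] [Field E] [Algebra K E] [Fintype K]

/-- The `K`-linear map obtained by evaluating a polynomial at the Frobenius and applying the result
to `w`. -/
def frobeniusApply (w : E) : K[X] →ₗ[K] E :=
  (LinearMap.applyₗ w) ∘ₗ (aeval (FiniteField.frobeniusAlgHom K E).toLinearMap).toLinearMap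

lemma frobeniusApply_def (w : E) (p : K[X]) : frobeniusApply K w p =
    aeval (FiniteField.frobeniusAlgHom K E).toLinearMap p w := rfl

lemma frobeniusApply_mul (w : E) (p r : K[X]) :
    frobeniusApply K w (p * r) = frobeniusApply K (frobeniusApply K w r) p := by
  simp [frobeniusApply_def]

lemma frobeniusApply_X_pow (w : E) (i : ℕ) :
    frobeniusApply K w (X ^ i) = w ^ (Nat.card K ^ i) := by
  rw [frobeniusApply_def, aeval_X_pow, Module.End.coe_pow, Nat.card_eq_fintype_card]
  exact congrFun (pow_iterate (Fintype.card K) i) w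

lemma frobeniusApply_one (w : E) : frobeniusApply K w 1 = w := by
  simp [frobeniusApply_def]

variable [Finite E]

lemma frobeniusApply_eq_zero_of_dvd (w : E) {p : K[X]}
    (h : X ^ Module.finrank K E - 1 ∣ p) : frobeniusApply K w p = 0 := by
  rw [← FiniteField.minpoly_frobeniusAlgHom K E, minpoly.dvd_iff] at h
  rw [frobeniusApply_def, h, LinearMap.zero_apply]

/-- Reduction modulo X^m - 1, which annihilates E, shows that the module generated by `w` is spanned
by its first m conjugates. If they span, independence is automatic in dimension m. -/
lemma isNormalElement_iff_surjective (w : E) :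
    IsNormalElement K w ↔ Function.Surjective (frobeniusApply K w) := by
  have : Module.Finite K E := Module.Finite.of_finite
  rw [← LinearMap.range_eq_top]
  constructor
  · rintro ⟨-, h⟩
    rw [eq_top_iff, ← h, Submodule.span_le]
    rintro _ ⟨i, rfl⟩
    exact ⟨X ^ (i : ℕ), frobeniusApply_X_pow K w i⟩
  · intro h
    have hs : ⊤ ≤ Submodule.span K
      (Set.range (fun i : Fin (Module.finrank K E) => w ^ (Nat.card K ^ (i : ℕ)))) := by
      rw [← h]
      rintro _ ⟨p, rfl⟩
      have hnd : (X ^ Module.finrank K E - 1 : K[X]).natDegree = Module.finrank K E :=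
        natDegree_X_pow_sub_C (r := (1 : K))
      have hm : (X ^ Module.finrank K E - 1 : K[X]).Monic :=
        leadingCoeff_X_pow_sub_one Module.finrank_pos
      have hmod := modByMonic_add_div p (X ^ Module.finrank K E - 1 : K[X])
      rw [← hmod, map_add, frobeniusApply_eq_zero_of_dvd K w (dvd_mul_right _ _), add_zero]
      set r := p %ₘ (X ^ Module.finrank K E - 1 : K[X])
      have hdeg : r.natDegree < Module.finrank K E := by
        have h1 := natDegree_modByMonic_lt p hm (by
          intro h1
          have := congrArg natDegree h1
          rw [hnd, natDegree_one] at this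
          exact Module.finrank_pos.ne' this)
        rwa [hnd] at h1
      rw [r.as_sum_range' _ hdeg, map_sum]
      refine Submodule.sum_mem _ fun i hi => ?_
      rw [← C_mul_X_pow_eq_monomial, ← smul_eq_C_mul, map_smul, frobeniusApply_X_pow]
      exact Submodule.smul_mem _ _ (Submodule.subset_span
        ⟨⟨i, Finset.mem_range.1 hi⟩, rfl⟩)
    exact ⟨linearIndependent_of_top_le_span_of_card_eq_finrank hs (Fintype.card_fin _),
      top_le_iff.1 hs⟩

variable (E) in
-- The normal basis theorem, with the Galois group indexed by powers of Frobenius.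
lemma exists_isNormalElement : ∃ w : E, IsNormalElement K w := by
  have : Module.Finite K E := Module.Finite.of_finite
  obtain ⟨w, hw⟩ := exists_linearIndependent_algEquiv_apply K E
  have h := hw.comp _ (FiniteField.bijective_frobeniusAlgEquivOfAlgebraic_pow K E).1
  have h' : LinearIndependent K
      (fun i : Fin (Module.finrank K E) => w ^ (Nat.card K ^ (i : ℕ))) := by
    convert h using 2 with i
    rw [Function.comp_apply, AlgEquiv.coe_pow,
      FiniteField.coe_frobeniusAlgEquivOfAlgebraic_iterate, Nat.card_eq_fintype_card]
  exact ⟨w, h', h'.span_eq_top_of_card_eq_finrank' (Fintype.card_fin _)⟩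

variable {K}

/-- Polynomials in Frobenius commute, so whatever kills the generator `w` kills E, and is then
divisible by the minimal polynomial X^m - 1 of Frobenius. -/
lemma frobeniusApply_eq_zero_iff {w : E} (hw : IsNormalElement K w) (p : K[X]) :
    frobeniusApply K w p = 0 ↔ X ^ Module.finrank K E - 1 ∣ p := by
  refine ⟨fun h => ?_, frobeniusApply_eq_zero_of_dvd K w⟩
  rw [← FiniteField.minpoly_frobeniusAlgHom K E, minpoly.dvd_iff]
  ext e
  obtain ⟨r, rfl⟩ := (isNormalElement_iff_surjective K w).1 hw e
  rw [← frobeniusApply_def, ← frobeniusApply_mul, mul_comm, frobeniusApply_mul, h]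
  simp [frobeniusApply_def]

lemma isNormalElement_frobeniusApply_iff {w : E} (hw : IsNormalElement K w) (p : K[X]) :
    IsNormalElement K (frobeniusApply K w p) ↔ IsCoprime p (X ^ Module.finrank K E - 1) := by
  have hs := (isNormalElement_iff_surjective K w).1 hw
  rw [isNormalElement_iff_surjective]
  constructor
  · intro h
    obtain ⟨t, ht⟩ := h w
    rw [← frobeniusApply_mul, ← sub_eq_zero] at ht
    nth_rewrite 2 [← frobeniusApply_one K w] at ht
    rw [← map_sub, frobeniusApply_eq_zero_iff hw] at ht
    obtain ⟨b, hb⟩ := ht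
    exact ⟨t, -b, by linear_combination hb⟩
  · rintro ⟨a, b, hab⟩ e
    obtain ⟨r, rfl⟩ := hs e
    refine ⟨r * a, ?_⟩
    rw [← frobeniusApply_mul, ← sub_eq_zero, ← map_sub]
    exact frobeniusApply_eq_zero_of_dvd K w ⟨-(b * r), by linear_combination r * hab⟩

variable (K) in
/-- The number of normal elements. -/
lemma card_isNormalElement :
    Nat.card {w : E // IsNormalElement K w} = polyPhi K (Module.finrank K E) := by
  obtain ⟨w, hw⟩ := exists_isNormalElement K E
  have hs := (isNormalElement_iff_surjective K w).1 hw
  set f : K[X] := X ^ Module.finrank K E - 1 with hf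
  have hker : LinearMap.ker (frobeniusApply K w) = (Ideal.span {f}).restrictScalars K := by
    ext p
    rw [LinearMap.mem_ker, frobeniusApply_eq_zero_iff hw, Submodule.restrictScalars_mem,
      Ideal.mem_span_singleton]
  -- A normal `w` identifies E with K[X]/(f); generators of this cyclic module correspond to units
  -- of the ring.
  let Φ : (K[X] ⧸ Ideal.span {f}) → E := Quotient.lift (s := Submodule.quotientRel _)
    (frobeniusApply K w) (by
      intro a b hab
      have hab' : a - b ∈ Ideal.span {f} := (Submodule.quotientRel_def _).1 hab
      rwa [Ideal.mem_span_singleton, hf, ← frobeniusApply_eq_zero_iff hw, map_sub, sub_eq_zero]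
        at hab')
  have hΦ : ∀ p, Φ (Ideal.Quotient.mk _ p) = frobeniusApply K w p := fun p => rfl
  have hbij : Function.Bijective Φ := by
    constructor
    · intro x y hxy
      obtain ⟨a, rfl⟩ := Ideal.Quotient.mk_surjective x
      obtain ⟨b, rfl⟩ := Ideal.Quotient.mk_surjective y
      rw [hΦ, hΦ, ← sub_eq_zero, ← map_sub, frobeniusApply_eq_zero_iff hw] at hxy
      exact Ideal.Quotient.eq.2 (Ideal.mem_span_singleton.2 hxy)
    · intro e
      obtain ⟨p, rfl⟩ := hs e
      exact ⟨_, hΦ p⟩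
  have hunit : ∀ x, IsUnit x ↔ IsNormalElement K (Φ x) := by
    intro x
    obtain ⟨p, rfl⟩ := Ideal.Quotient.mk_surjective x
    rw [hΦ, isNormalElement_frobeniusApply_iff hw]
    constructor
    · intro h
      obtain ⟨y, hy⟩ := h.exists_left_inv
      obtain ⟨t, rfl⟩ := Ideal.Quotient.mk_surjective y
      rw [← map_mul, ← map_one (Ideal.Quotient.mk _), Ideal.Quotient.eq,
        Ideal.mem_span_singleton] at hy
      obtain ⟨b, hb⟩ := hy
      exact ⟨t, -b, by linear_combination hb⟩
    · rintro ⟨a, b, hab⟩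
      refine .of_mul_eq_one (Ideal.Quotient.mk _ a) ?_
      rw [← map_mul, ← map_one (Ideal.Quotient.mk _), Ideal.Quotient.eq,
        Ideal.mem_span_singleton]
      exact ⟨-b, by linear_combination hab⟩
  rw [polyPhi]
  refine (Nat.card_congr (((Equiv.ofBijective Φ hbij).subtypeEquiv hunit).symm.trans ?_))
  exact (Equiv.ofBijective (fun u : (K[X] ⧸ Ideal.span {f})ˣ => (⟨(u : K[X] ⧸ Ideal.span {f}), u.isUnit⟩ :
      {x : K[X] ⧸ Ideal.span {f} // IsUnit x}))
    ⟨fun u v h => Units.ext (Subtype.ext_iff.1 h), fun x => ⟨x.2.unit, rfl⟩⟩).symm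

end Normal

/-! ### Irreducible divisors of x^m - 1. -/

section Factors

variable (K : Type*) [Field K]

/-- The monic irreducible divisors of `x ^ m - 1`. -/
def irredDivisors (m : ℕ) : Finset K[X] := by
  classical exact (UniqueFactorizationMonoid.normalizedFactors (X ^ m - 1 : K[X])).toFinset

variable {K} {m : ℕ}

lemma X_pow_sub_one_ne_zero' (hm : m ≠ 0) : (X ^ m - 1 : K[X]) ≠ 0 :=
  X_pow_sub_C_ne_zero (Nat.pos_of_ne_zero hm) 1

lemma mem_irredDivisors (hm : m ≠ 0) {p : K[X]} :
    p ∈ irredDivisors K m ↔ p.Monic ∧ Irreducible p ∧ p ∣ X ^ m - 1 := by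
  classical
  rw [irredDivisors, Multiset.mem_toFinset,
    UniqueFactorizationMonoid.mem_normalizedFactors_iff' (X_pow_sub_one_ne_zero' hm)]
  constructor
  · rintro ⟨h1, h2, h3⟩
    exact ⟨h2 ▸ monic_normalize h1.ne_zero, h1, h3⟩
  · rintro ⟨h1, h2, h3⟩
    exact ⟨h2, h1.normalize_eq_self, h3⟩

lemma numIrredDivisors_eq_card (hm : m ≠ 0) :
    numIrredDivisors K m = (irredDivisors K m).card := by
  rw [numIrredDivisors, ← Nat.card_eq_finsetCard]
  exact Nat.card_congr (Equiv.subtypeEquivRight fun p => (mem_irredDivisors hm).symm)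

end Factors

/-! ### The proportion of units in K[x]/(x^m - 1). -/

section Density

variable (K : Type*) [Field K] {m : ℕ}

/-- The product of `1 - |K| ^ (-deg p)` over the monic irreducible divisors `p` of `x ^ m - 1`. -/
def irredDensity (m : ℕ) : ℝ :=
  ∏ p ∈ irredDivisors K m, (1 - ((Nat.card K : ℝ) ^ p.natDegree)⁻¹)

variable {K}

lemma natCard_quotient_span [Finite K] {p : K[X]} (hp : p ≠ 0) :
    Nat.card (K[X] ⧸ Ideal.span {p}) = Nat.card K ^ p.natDegree := by
  have : Module.Finite K (AdjoinRoot p) := (AdjoinRoot.powerBasis hp).finite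
  have : Module.Finite K (K[X] ⧸ Ideal.span {p}) := this
  rw [Module.natCard_eq_pow_finrank (K := K), finrank_quotient_span_eq_natDegree]

lemma isCoprime_iff_forall_not_dvd_irredDivisors (hm : m ≠ 0) (s : K[X]) :
    IsCoprime s (X ^ m - 1) ↔ ∀ p ∈ irredDivisors K m, ¬ p ∣ s := by
  classical
  constructor
  · intro h p hp hps
    obtain ⟨h1, h2, h3⟩ := (mem_irredDivisors hm).1 hp
    exact h2.not_isUnit (h.isUnit_of_dvd' hps h3)
  · intro h
    refine isCoprime_of_irreducible_dvd (fun h0 => X_pow_sub_one_ne_zero' hm h0.2) ?_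
    intro z hz hzs hzf
    have hn : Associated (normalize z) z := normalize_associated z
    exact h (normalize z) ((mem_irredDivisors hm).2 ⟨monic_normalize hz.ne_zero,
      hn.symm.irreducible hz, hn.dvd.trans hzf⟩) (hn.dvd.trans hzs)

lemma prod_irredDivisors (hm : (m : K) ≠ 0) : ∏ p ∈ irredDivisors K m, p = X ^ m - 1 := by
  classical
  have hm0 : m ≠ 0 := by rintro rfl; simp at hm
  have hsq : Squarefree (X ^ m - 1 : K[X]) := (X_pow_sub_one_separable_iff.2 hm).squarefree
  have hnd := (UniqueFactorizationMonoid.squarefree_iff_nodup_normalizedFactors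
    (X_pow_sub_one_ne_zero' hm0)).1 hsq
  rw [irredDivisors, Finset.prod, Multiset.toFinset_val, hnd.dedup, Multiset.map_id',
    UniqueFactorizationMonoid.prod_normalizedFactors_eq (X_pow_sub_one_ne_zero' hm0)]
  exact Monic.normalize_eq_self (leadingCoeff_X_pow_sub_one (Nat.pos_of_ne_zero hm0))

lemma isCoprime_of_mem_irredDivisors (hm : m ≠ 0) {p r : K[X]} (hp : p ∈ irredDivisors K m)
    (hr : r ∈ irredDivisors K m) (h : p ≠ r) : IsCoprime p r := by
  obtain ⟨h1, h2, -⟩ := (mem_irredDivisors hm).1 hp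
  obtain ⟨h1', h2', -⟩ := (mem_irredDivisors hm).1 hr
  rw [h2.coprime_iff_not_dvd]
  exact fun hd => h (eq_of_monic_of_associated h1 h1' (h2.associated_of_dvd h2' hd))

/-- When m is nonzero in K, x^m - 1 is squarefree, and the Chinese remainder theorem splits the
quotient into fields. -/
lemma polyPhi_eq_prod [Finite K] (hm : (m : K) ≠ 0) :
    polyPhi K m = ∏ p ∈ irredDivisors K m, (Nat.card K ^ p.natDegree - 1) := by
  classical
  have hm0 : m ≠ 0 := by rintro rfl; simp at hm
  have hcop : Pairwise (Function.onFun IsCoprime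
      (fun p : irredDivisors K m => Ideal.span {(p : K[X])})) := fun p r hpr => by
    rw [Function.onFun, Ideal.isCoprime_span_singleton_iff]
    exact isCoprime_of_mem_irredDivisors hm0 p.2 r.2 (Subtype.coe_ne_coe.2 hpr)
  have hinf : (⨅ p : irredDivisors K m, Ideal.span {(p : K[X])}) = Ideal.span {X ^ m - 1} := by
    rw [Ideal.iInf_span_singleton, ← prod_irredDivisors hm, Finset.prod_coe_sort _ (fun p => p)]
    exact fun p r hpr => isCoprime_of_mem_irredDivisors hm0 p.2 r.2 (Subtype.coe_ne_coe.2 hpr)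
  rw [polyPhi, ← hinf, Nat.card_congr ((Units.mapEquiv
    (Ideal.quotientInfRingEquivPiQuotient _ hcop).toMulEquiv).trans MulEquiv.piUnits).toEquiv,
    Nat.card_pi, ← Finset.prod_coe_sort (irredDivisors K m)
      (fun p => Nat.card K ^ p.natDegree - 1)]
  refine Finset.prod_congr rfl fun p _ => ?_
  obtain ⟨-, h2, -⟩ := (mem_irredDivisors hm0).1 p.2
  have : (Ideal.span {(p : K[X])}).IsMaximal :=
    PrincipalIdealRing.isMaximal_of_irreducible h2
  let : Field (K[X] ⧸ Ideal.span {(p : K[X])}) := Ideal.Quotient.field _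
  rw [Nat.card_units, natCard_quotient_span h2.ne_zero]

lemma polyPhi_div_eq_irredDensity [Finite K] (hm : (m : K) ≠ 0) :
    (polyPhi K m : ℝ) / (Nat.card K : ℝ) ^ m = irredDensity K m := by
  have hm0 : m ≠ 0 := by rintro rfl; simp at hm
  have hdeg : m = ∑ p ∈ irredDivisors K m, p.natDegree := by
    rw [← natDegree_prod _ _ fun p hp => ((mem_irredDivisors hm0).1 hp).2.1.ne_zero,
      prod_irredDivisors hm]
    exact (natDegree_X_pow_sub_C (r := (1 : K))).symm
  have hK : (Nat.card K : ℝ) ≠ 0 := Nat.cast_ne_zero.2 Nat.card_pos.ne'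
  conv_lhs => rw [polyPhi_eq_prod hm]; arg 2; rw [hdeg]
  rw [← Finset.prod_pow_eq_pow_sum, Nat.cast_prod, ← Finset.prod_div_distrib, irredDensity]
  refine Finset.prod_congr rfl fun p _ => ?_
  rw [Nat.cast_sub (Nat.one_le_pow _ _ Nat.card_pos)]
  push_cast
  field_simp

/-- In characteristic p, x^m - 1 is a p-power of x^{m'} - 1, so only multiplicities change. -/
lemma irredDivisors_ordCompl (p : ℕ) [Fact p.Prime] [CharP K p] (hm : m ≠ 0) :
    irredDivisors K (ordCompl[p] m) = irredDivisors K m := by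
  have hm' : ordCompl[p] m ≠ 0 := (Nat.ordCompl_pos p hm).ne'
  ext f
  rw [mem_irredDivisors hm, mem_irredDivisors hm']
  refine and_congr_right fun _ => and_congr_right fun hf => ?_
  have : (X ^ m - 1 : K[X]) = (X ^ (ordCompl[p] m) - 1) ^ (p ^ m.factorization p) := by
    rw [sub_pow_char_pow, one_pow, ← pow_mul, mul_comm, Nat.ordProj_mul_ordCompl_eq_self]
  rw [this]
  exact ⟨fun h => h.trans (dvd_pow_self _ (pow_pos (Fact.out : p.Prime).pos _).ne'),
    fun h => hf.prime.dvd_of_dvd_pow h⟩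

lemma irredDensity_nonneg [Finite K] : 0 ≤ irredDensity K m :=
  Finset.prod_nonneg fun p _ => sub_nonneg.2 (inv_le_one_of_one_le₀
    (one_le_pow₀ (by exact_mod_cast Nat.one_le_iff_ne_zero.2 Nat.card_pos.ne')))

/-- The divisor X - 1 always occurs and contributes a factor below 1. -/
lemma irredDensity_lt_one [Finite K] (hm : m ≠ 0) : irredDensity K m < 1 := by
  classical
  have hK : (1 : ℝ) < Nat.card K := by exact_mod_cast Finite.one_lt_card
  have h1 : (X - C 1 : K[X]) ∈ irredDivisors K m := by
    refine (mem_irredDivisors hm).2 ⟨monic_X_sub_C 1, irreducible_X_sub_C 1, ?_⟩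
    rw [dvd_iff_isRoot]; simp
  rw [irredDensity, ← Finset.mul_prod_erase _ _ h1]
  refine mul_lt_one_of_nonneg_of_lt_one_left ?_ ?_ (Finset.prod_le_one ?_ ?_)
  · exact sub_nonneg.2 (inv_le_one_of_one_le₀ (one_le_pow₀ hK.le))
  · exact sub_lt_self _ (inv_pos.2 (pow_pos (by linarith) _))
  · exact fun p _ => sub_nonneg.2 (inv_le_one_of_one_le₀ (one_le_pow₀ hK.le))
  · exact fun p _ => sub_le_self _ (inv_nonneg.2 (pow_nonneg (by linarith) _))

lemma card_irredDivisors_pos (hm : m ≠ 0) : 0 < (irredDivisors K m).card := by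
  refine Finset.card_pos.2 ⟨X - C 1, (mem_irredDivisors hm).2
    ⟨monic_X_sub_C 1, irreducible_X_sub_C 1, ?_⟩⟩
  rw [dvd_iff_isRoot]; simp

end Density

/-! ### Normality as avoidance of additive subgroups. -/

section NormalIndicator

variable {K E : Type*} [Field K] [Field E] [Algebra K E] [Fintype K]

/-- For a divisor `p` of `f = x ^ m - 1`, the elements of `E` killed by `f / p`. -/
def frobeniusKer (E : Type*) [Field E] [Algebra K E] (p : K[X]) : AddSubgroup E :=
  (LinearMap.ker (aeval (FiniteField.frobeniusAlgHom K E).toLinearMap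
    ((X ^ Module.finrank K E - 1) / p))).toAddSubgroup

variable [Fintype E]

/-- With f = X^m - 1, the polynomial (f/p) s kills the generator `w` iff f divides it, and f/p
cancels. -/
lemma frobeniusApply_mem_frobeniusKer_iff {w : E} (hw : IsNormalElement K w) {p : K[X]}
    (hp : p ∈ irredDivisors K (Module.finrank K E)) (s : K[X]) :
    frobeniusApply K w s ∈ frobeniusKer E p ↔ p ∣ s := by
  obtain ⟨-, h2, h3⟩ := (mem_irredDivisors Module.finrank_pos.ne').1 hp
  rw [frobeniusKer, Submodule.mem_toAddSubgroup, LinearMap.mem_ker, ← frobeniusApply_def,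
    ← frobeniusApply_mul, frobeniusApply_eq_zero_iff hw]
  have hf := EuclideanDomain.mul_div_cancel' h2.ne_zero h3
  set g := (X ^ Module.finrank K E - 1) / p
  have hg : g ≠ 0 := fun h => X_pow_sub_one_ne_zero' (K := K)
    (Module.finrank_pos (R := K) (M := E)).ne' (by rw [← hf, h, mul_zero])
  rw [← hf, mul_comm p g]
  exact mul_dvd_mul_iff_left hg

/-- The preimage of this subgroup under the surjection K[X] → E is the ideal (p). -/
lemma index_frobeniusKer {p : K[X]} (hp : p ∈ irredDivisors K (Module.finrank K E)) :
    (frobeniusKer E p).index = Nat.card K ^ p.natDegree := by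
  obtain ⟨w, hw⟩ := exists_isNormalElement K E
  obtain ⟨-, h2, h3⟩ := (mem_irredDivisors Module.finrank_pos.ne').1 hp
  rw [← natCard_quotient_span h2.ne_zero, ← AddSubgroup.index_comap_of_surjective (frobeniusKer E p)
    (f := (frobeniusApply K w).toAddMonoidHom) ((isNormalElement_iff_surjective K w).1 hw)]
  have : (frobeniusKer E p).comap (frobeniusApply K w).toAddMonoidHom =
      (Ideal.span {p}).toAddSubgroup := by
    ext s
    rw [Submodule.mem_toAddSubgroup, Ideal.mem_span_singleton,
      ← frobeniusApply_mem_frobeniusKer_iff hw hp]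
    rfl
  rw [this]
  rfl

lemma isNormalElement_iff_forall_notMem (v : E) : IsNormalElement K v ↔
    ∀ p ∈ irredDivisors K (Module.finrank K E), v ∉ frobeniusKer E p := by
  obtain ⟨w, hw⟩ := exists_isNormalElement K E
  obtain ⟨s, rfl⟩ := (isNormalElement_iff_surjective K w).1 hw v
  rw [isNormalElement_frobeniusApply_iff hw,
    isCoprime_iff_forall_not_dvd_irredDivisors Module.finrank_pos.ne']
  exact forall₂_congr fun p hp => not_congr (frobeniusApply_mem_frobeniusKer_iff hw hp s).symm

open Classical in
variable (K E) in
lemma hasWienerBound_isNormalElement :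
    HasWienerBound (fun v : E => if IsNormalElement K v then 1 else 0)
      (irredDensity K (Module.finrank K E) *
        2 ^ (irredDivisors K (Module.finrank K E)).card) := by
  have h := HasWienerBound.prod (A := E) (irredDivisors K (Module.finrank K E))
    (fun p hp => HasWienerBound.compl_addSubgroup (frobeniusKer E p))
  rw [Finset.prod_mul_distrib, Finset.prod_const, mul_comm] at h
  have hp : ∏ p ∈ irredDivisors K (Module.finrank K E), (1 - ((frobeniusKer E p).index : ℝ)⁻¹) =
      irredDensity K (Module.finrank K E) :=
    Finset.prod_congr rfl fun p hp => by rw [index_frobeniusKer hp, Nat.cast_pow]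
  rw [hp] at h
  refine h.congr fun v => ?_
  rw [Finset.prod_apply, isNormalElement_iff_forall_notMem]
  split_ifs with hu
  · exact Finset.prod_eq_one fun p hp => if_neg (hu p hp)
  · push Not at hu
    obtain ⟨p, hp, hu⟩ := hu
    exact Finset.prod_eq_zero hp (if_pos hu)

end NormalIndicator

/-! ### Bounding 2^ω. -/

section PrimeFactors

/-- Compare the product of `256 / r` over the prime factors `r` of `N` with the product over all
primes `r < 256`: the factors with `r > 256` are less than `1`. -/
lemma two_pow_card_primeFactors_pow_le {N : ℕ} (hN : N ≠ 0) :
    ((2 : ℝ) ^ N.primeFactors.card) ^ 8 ≤ 4514.7 ^ 8 * N := by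
  -- The primes below 256 = 16^2, recognised by trial division by numbers below 16. The cutoff is
  -- 2^8 because the eighth power of 2^ω is compared with N.
  let T : Finset ℕ := (Finset.range 256).filter
    fun r => 2 ≤ r ∧ ∀ k ∈ Finset.range 16, 2 ≤ k → k < r → ¬ k ∣ r
  have hT : 256 ^ T.card * 10 ^ 8 ≤ 45147 ^ 8 * ∏ r ∈ T, r := by decide +kernel
  have hTr : ∀ r ∈ T, (0 : ℝ) < r ∧ (r : ℝ) ≤ 256 := fun r hr => by
    obtain ⟨h1, h2, -⟩ := Finset.mem_filter.1 hr
    exact ⟨by exact_mod_cast (by omega : 0 < r),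
      by exact_mod_cast (Finset.mem_range.1 h1).le⟩
  have hT' : ∏ r ∈ T, (256 / r : ℝ) ≤ 4514.7 ^ 8 := by
    rw [Finset.prod_div_distrib, Finset.prod_const, div_le_iff₀
      (Finset.prod_pos fun r hr => (hTr r hr).1)]
    have : ((256 ^ T.card * 10 ^ 8 : ℕ) : ℝ) ≤ ((45147 ^ 8 * ∏ r ∈ T, r : ℕ) : ℝ) := by
      exact_mod_cast hT
    rw [Nat.cast_mul, Nat.cast_mul, Nat.cast_prod, Nat.cast_pow, Nat.cast_pow, Nat.cast_pow] at this
    have h2 : (4514.7 : ℝ) ^ 8 = 45147 ^ 8 / 10 ^ 8 := by norm_num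
    rw [h2, div_mul_eq_mul_div, le_div_iff₀ (by positivity)]
    exact_mod_cast this
  have hS : ∀ r ∈ N.primeFactors, (0 : ℝ) < r := fun r hr =>
    Nat.cast_pos.2 (Nat.prime_of_mem_primeFactors hr).pos
  have h1 : ∏ r ∈ N.primeFactors, (256 / r : ℝ) ≤ ∏ r ∈ T, (256 / r : ℝ) := by
    rw [← Finset.prod_filter_mul_prod_filter_not N.primeFactors (fun r => r < 256)]
    refine (mul_le_of_le_one_right (Finset.prod_nonneg fun r _ => by positivity)
      (Finset.prod_le_one (fun r _ => by positivity) fun r hr => ?_)).trans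
      (Finset.prod_le_prod_of_subset_of_one_le ?_ (fun r _ => by positivity) ?_)
    · obtain ⟨hr, h⟩ := Finset.mem_filter.1 hr
      rw [div_le_one (hS r hr)]
      exact_mod_cast not_lt.1 h
    · intro r hr
      obtain ⟨hr, h⟩ := Finset.mem_filter.1 hr
      have hp := Nat.prime_of_mem_primeFactors hr
      refine Finset.mem_filter.2 ⟨Finset.mem_range.2 h, hp.two_le, fun k _ hk hkr hd => ?_⟩
      rcases (Nat.dvd_prime hp).1 hd with h | h <;> omega
    · intro r hr _
      rw [le_div_iff₀ (hTr r hr).1, one_mul]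
      exact (hTr r hr).2
  rw [Finset.prod_div_distrib, Finset.prod_const, div_le_iff₀ (Finset.prod_pos hS)] at h1
  calc ((2 : ℝ) ^ N.primeFactors.card) ^ 8 = 256 ^ N.primeFactors.card := by
        rw [← pow_mul, mul_comm, pow_mul]; norm_num
    _ ≤ (∏ r ∈ T, (256 / r : ℝ)) * ∏ r ∈ N.primeFactors, (r : ℝ) := h1
    _ ≤ 4514.7 ^ 8 * N := by
        refine mul_le_mul hT' ?_ (Finset.prod_nonneg fun r hr => (hS r hr).le) (by positivity)
        rw [← Nat.cast_prod]
        exact_mod_cast Nat.le_of_dvd (Nat.pos_of_ne_zero hN) (Nat.prod_primeFactors_dvd N)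

lemma two_pow_card_primeFactors_le {q n : ℕ} (hq : 2 ≤ q) (hn : n ≠ 0) :
    (2 : ℝ) ^ (q ^ n - 1).primeFactors.card ≤ 4514.7 * (q : ℝ) ^ ((n : ℝ) / 8) := by
  have hN : q ^ n - 1 ≠ 0 := by
    have := Nat.one_lt_pow hn (by omega : 1 < q)
    omega
  refine le_of_pow_le_pow_left₀ (n := 8) (by norm_num) (by positivity)
    ((two_pow_card_primeFactors_pow_le hN).trans ?_)
  rw [mul_pow, ← Real.rpow_mul_natCast (by positivity)]
  have : (n : ℝ) / 8 * (8 : ℕ) = n := by push_cast; ring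
  rw [this, Real.rpow_natCast]
  gcongr
  exact_mod_cast Nat.sub_le _ _

end PrimeFactors

/-! ### Counting elements by degree and by failure of normality. -/

section Counting

open Function


/-- The power map `x ↦ x ^ (|F| ^ d)`. -/
def powCardPow (F : Type*) {E : Type*} [Monoid E] (d : ℕ) (x : E) : E := x ^ (Nat.card F ^ d)

lemma powCardPow_iterate (F : Type*) {E : Type*} [Monoid E] (d b : ℕ) (x : E) :
    (powCardPow F d)^[b] x = x ^ (Nat.card F ^ (d * b)) := by
  rw [pow_mul]
  exact congrFun (pow_iterate (Nat.card F ^ d) b) x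

variable (F E : Type*) [Field F] [Field E] [Finite E] [Algebra F E]

lemma natCard_eq_pow_finrank : Nat.card E = Nat.card F ^ Module.finrank F E := by
  have : Module.Finite F E := Module.Finite.of_finite
  exact Module.natCard_eq_pow_finrank

lemma finrank_ne_zero' : Module.finrank F E ≠ 0 := by
  have : Module.Finite F E := Module.Finite.of_finite
  exact Module.finrank_pos.ne'

variable {F E}

lemma not_isCompletelyNormal_zero : ¬ IsCompletelyNormal F (0 : E) := by
  intro h
  have h0 := (h ⊥).1.ne_zero ⟨0, Nat.pos_of_ne_zero (finrank_ne_zero' _ _)⟩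
  exact h0 (zero_pow (pow_pos Nat.card_pos _).ne')

lemma minimalPeriod_powCardPow_dvd {d : ℕ} (hd : d ∣ Module.finrank F E) (x : E) :
    minimalPeriod (powCardPow F d) x ∣ Module.finrank F E / d := by
  have := Fintype.ofFinite E
  rw [← isPeriodicPt_iff_minimalPeriod_dvd, IsPeriodicPt, IsFixedPt, powCardPow_iterate,
    Nat.mul_div_cancel' hd, ← natCard_eq_pow_finrank F E, Nat.card_eq_fintype_card,
    FiniteField.pow_card]

lemma minimalPeriod_powCardPow_of_one {d : ℕ} (hd : d ∣ Module.finrank F E) {w : E}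
    (hw : minimalPeriod (powCardPow F 1) w = Module.finrank F E) :
    minimalPeriod (powCardPow F d) w = Module.finrank F E / d := by
  have : powCardPow F (E := E) d = (powCardPow F 1)^[d] := by
    ext x; rw [powCardPow_iterate, one_mul]; rfl
  rw [this, minimalPeriod_iterate_eq_div_gcd, hw, Nat.gcd_eq_right hd]
  rintro rfl
  exact finrank_ne_zero' F E (Nat.eq_zero_of_zero_dvd hd)

variable [Finite F]

/-- X^{q^d} - X divides X^{q^n} - X, which splits in E with simple roots. -/
lemma natCard_subfieldOfDegree {d : ℕ} (hd : d ∣ Module.finrank F E) :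
    Nat.card (subfieldOfDegree F E d) = Nat.card F ^ d := by
  classical
  have := Fintype.ofFinite E
  have hd0 : d ≠ 0 := fun h => finrank_ne_zero' F E (Nat.eq_zero_of_zero_dvd (h ▸ hd))
  have hq : 1 < Nat.card F := Finite.one_lt_card
  have hQ : 1 < Nat.card F ^ d := Nat.one_lt_pow hd0 hq
  obtain ⟨k, hk⟩ := hd
  have hcard : Fintype.card E = (Nat.card F ^ d) ^ k := by
    rw [← Nat.card_eq_fintype_card, natCard_eq_pow_finrank F E, hk, pow_mul]
  have hsplit : (X ^ Fintype.card E - X : E[X]).Splits := by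
    rw [splits_iff_card_roots, FiniteField.roots_X_pow_card_sub_X,
      FiniteField.X_pow_card_sub_X_natDegree_eq E Fintype.one_lt_card]
    rfl
  have hne : (X ^ Fintype.card E - X : E[X]) ≠ 0 :=
    FiniteField.X_pow_card_sub_X_ne_zero E Fintype.one_lt_card
  have hdvd : (X ^ (Nat.card F ^ d) - X : E[X]) ∣ X ^ Fintype.card E - X := by
    rw [hcard]
    obtain ⟨c, hc⟩ : Nat.card F ^ d - 1 ∣ (Nat.card F ^ d) ^ k - 1 := by
      simpa using Nat.sub_dvd_pow_sub_pow (Nat.card F ^ d) 1 k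
    have h1 : (Nat.card F ^ d) ^ k = (Nat.card F ^ d - 1) * c + 1 := by
      rw [← hc]
      have := Nat.one_le_pow k (Nat.card F ^ d) (by omega)
      omega
    rw [h1]
    have h2 : (X ^ (Nat.card F ^ d) - X : E[X]) = (X ^ (Nat.card F ^ d - 1) - 1) * X := by
      rw [sub_mul, one_mul, ← pow_succ, Nat.sub_add_cancel hQ.le]
    rw [h2, pow_succ, pow_mul, ← sub_one_mul]
    exact mul_dvd_mul_right (sub_one_dvd_pow_sub_one _ c) X
  have hs := hsplit.of_dvd hne hdvd
  have hnd := (FiniteField.roots_X_pow_card_sub_X E ▸ Finset.univ.nodup :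
    (X ^ Fintype.card E - X : E[X]).roots.Nodup)
  have hnd' : (X ^ (Nat.card F ^ d) - X : E[X]).roots.Nodup :=
    Multiset.nodup_of_le (roots.le_of_dvd hne hdvd) hnd
  rw [← FiniteField.X_pow_card_sub_X_natDegree_eq E hQ, hs.natDegree_eq_card_roots,
    ← Multiset.toFinset_card_of_nodup hnd', ← Nat.card_eq_finsetCard]
  refine Nat.card_congr (Equiv.subtypeEquivRight fun x => ?_)
  rw [Multiset.mem_toFinset, mem_roots (FiniteField.X_pow_card_sub_X_ne_zero E hQ), IsRoot.def,
    eval_sub, eval_pow, eval_X, sub_eq_zero]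
  rfl

lemma finrank_subfieldOfDegree {d : ℕ} (hd : d ∣ Module.finrank F E) :
    Module.finrank (subfieldOfDegree F E d) E = Module.finrank F E / d := by
  have hd0 : d ≠ 0 := fun h => finrank_ne_zero' F E (Nat.eq_zero_of_zero_dvd (h ▸ hd))
  have h := natCard_eq_pow_finrank (subfieldOfDegree F E d) E
  rw [natCard_subfieldOfDegree hd, natCard_eq_pow_finrank F E, ← pow_mul] at h
  rw [Nat.pow_right_injective Finite.one_lt_card h,
    Nat.mul_div_cancel_left _ (Nat.pos_of_ne_zero hd0)]

lemma natCard_isPeriodicPt {d b : ℕ} (hd : d * b ∣ Module.finrank F E) :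
    Nat.card {x : E // IsPeriodicPt (powCardPow F d) b x} = Nat.card F ^ (d * b) := by
  rw [← natCard_subfieldOfDegree hd]
  refine Nat.card_congr (Equiv.subtypeEquivRight fun x => ?_)
  rw [IsPeriodicPt, IsFixedPt, powCardPow_iterate]
  rfl

/-- The number of elements of maximal degree over the subfield with `|F| ^ d` elements. -/
lemma natCard_minimalPeriod_eq {d : ℕ} (hd : d ∣ Module.finrank F E) :
    (Nat.card {x : E // minimalPeriod (powCardPow F d) x = Module.finrank F E / d} : ℤ) =
      ∑ a ∈ (Module.finrank F E / d).divisors,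
        ArithmeticFunction.moebius (Module.finrank F E / (d * a)) *
          (Nat.card F : ℤ) ^ (d * a) := by
  classical
  have := Fintype.ofFinite E
  have hm0 : Module.finrank F E / d ≠ 0 :=
    (Nat.div_pos (Nat.le_of_dvd (Nat.pos_of_ne_zero (finrank_ne_zero' F E)) hd)
      (Nat.pos_of_dvd_of_pos hd (Nat.pos_of_ne_zero (finrank_ne_zero' F E)))).ne'
  -- Möbius inversion, restricted to divisors b of n/d: the points fixed by the b-th iterate form
  -- the field with q^{db} elements, and their minimal periods are the divisors of b.
  have key := (ArithmeticFunction.sum_eq_iff_sum_mul_moebius_eq_on (R := ℤ)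
    (f := fun b => (Nat.card {x : E // minimalPeriod (powCardPow F d) x = b} : ℤ))
    (g := fun b => (Nat.card F : ℤ) ^ (d * b)) {b | b ∣ Module.finrank F E / d}
    (fun a b h1 h2 => h1.trans h2)).1 (fun b hb hbm => by
      have hdb : d * b ∣ Module.finrank F E := by
        rw [← Nat.mul_div_cancel' hd]; exact mul_dvd_mul_left d hbm
      have h1 := natCard_isPeriodicPt hdb
      simp_rw [Nat.card_eq_fintype_card (α := {x : E // _}), Fintype.card_subtype] at h1 ⊢
      rw [← Nat.cast_pow, ← h1, Finset.card_eq_sum_card_fiberwise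
        (f := minimalPeriod (powCardPow F d)) (t := b.divisors)]
      · rw [Nat.cast_sum]
        refine Finset.sum_congr rfl fun i hi => ?_
        congr 2
        ext x
        simp only [Finset.mem_filter, Finset.mem_univ, true_and]
        exact ⟨fun h => ⟨isPeriodicPt_iff_minimalPeriod_dvd.2 (h ▸ Nat.dvd_of_mem_divisors hi), h⟩,
          fun h => h.2⟩
      · intro x hx
        simp only [Finset.coe_filter, Finset.mem_univ, true_and, Set.mem_ofPred_eq] at hx
        exact Nat.mem_divisors.2 ⟨isPeriodicPt_iff_minimalPeriod_dvd.1 hx, hb.ne'⟩)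
    _ (Nat.pos_of_ne_zero hm0) (dvd_refl _)
  simp only [Int.cast_id] at key
  rw [← key, Nat.sum_divisorsAntidiagonal' (f := fun x y =>
    ArithmeticFunction.moebius x * (Nat.card F : ℤ) ^ (d * y))]
  refine Finset.sum_congr rfl fun a _ => ?_
  rw [Nat.div_div_eq_div_mul]

/-- Few elements lie in proper intermediate fields. -/
lemma natCard_minimalPeriod_ne_lt :
    Nat.card {x : E // minimalPeriod (powCardPow F 1) x ≠ Module.finrank F E} <
      2 * Nat.card F ^ (Module.finrank F E / 2) := by
  classical
  have := Fintype.ofFinite E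
  have hn := finrank_ne_zero' F E
  set n := Module.finrank F E with hn'
  have h1 : Nat.card {x : E // minimalPeriod (powCardPow F 1) x ≠ n} ≤
      ∑ j ∈ n.properDivisors, Nat.card F ^ j := by
    rw [Nat.card_eq_fintype_card, Fintype.card_subtype]
    refine (Finset.card_le_card (t := n.properDivisors.biUnion fun j =>
      Finset.univ.filter fun x : E => IsPeriodicPt (powCardPow F 1) j x) ?_).trans
      (Finset.card_biUnion_le.trans (Finset.sum_le_sum fun j hj => ?_))
    · intro x hx
      have hx := (Finset.mem_filter.1 hx).2
      have hdvd := minimalPeriod_powCardPow_dvd (F := F) (one_dvd _) x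
      rw [Nat.div_one] at hdvd
      refine Finset.mem_biUnion.2 ⟨minimalPeriod (powCardPow F 1) x,
        Nat.mem_properDivisors.2 ⟨hdvd, ?_⟩,
        Finset.mem_filter.2 ⟨Finset.mem_univ _, isPeriodicPt_minimalPeriod _ _⟩⟩
      exact lt_of_le_of_ne (Nat.le_of_dvd (Nat.pos_of_ne_zero hn) hdvd) hx
    · have := natCard_isPeriodicPt (F := F) (E := E) (d := 1) (b := j)
        (by rw [one_mul]; exact (Nat.mem_properDivisors.1 hj).1)
      rw [Nat.card_eq_fintype_card (α := {x : E // _}), Fintype.card_subtype, one_mul] at this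
      exact this.le
  -- Proper divisors are at most n/2, so the geometric sum is less than twice its top term.
  have h2 : n.properDivisors ⊆ Finset.range (n / 2 + 1) := by
    intro j hj
    obtain ⟨⟨k, hk⟩, hlt⟩ := Nat.mem_properDivisors.1 hj
    have hk2 : 2 ≤ k := by
      by_contra h
      interval_cases k <;> omega
    rw [Finset.mem_range, Nat.lt_succ_iff, Nat.le_div_iff_mul_le two_pos, hk]
    exact Nat.mul_le_mul_left j hk2
  calc _ ≤ ∑ j ∈ Finset.range (n / 2 + 1), Nat.card F ^ j :=
        h1.trans (Finset.sum_le_sum_of_subset h2)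
    _ < 2 * Nat.card F ^ (n / 2) := by
        rw [Finset.sum_range_succ, two_mul]
        exact Nat.add_lt_add_right (Nat.geomSum_lt Finite.one_lt_card
          fun k hk => Finset.mem_range.1 hk) _

/-- A shorter period would make two of the independent conjugates coincide. -/
lemma IsNormalElement.minimalPeriod_eq {d : ℕ} (hd : d ∣ Module.finrank F E) {w : E}
    (hw : IsNormalElement (subfieldOfDegree F E d) w) :
    minimalPeriod (powCardPow F d) w = Module.finrank F E / d := by
  have hdvd := minimalPeriod_powCardPow_dvd hd w
  have hpos : 0 < Module.finrank F E / d := by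
    rw [← finrank_subfieldOfDegree hd]
    exact Nat.pos_of_ne_zero (finrank_ne_zero' _ _)
  by_contra hne
  have hlt := lt_of_le_of_ne (Nat.le_of_dvd hpos hdvd) hne
  have hinj := hw.1.injective
  have h0 := Nat.pos_of_dvd_of_pos hdvd hpos
  rw [← finrank_subfieldOfDegree hd] at hlt hpos
  have := @hinj ⟨_, hlt⟩ ⟨0, hpos⟩ (by
    simp only [natCard_subfieldOfDegree hd, pow_zero, pow_one]
    rw [← pow_mul, ← powCardPow_iterate, iterate_minimalPeriod])
  exact h0.ne' (Fin.mk.inj_iff.1 this)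

/-- The number of elements of maximal degree over the subfield with `|F| ^ d` elements that are not
normal over it. -/
lemma natCard_not_isNormalElement {d : ℕ} (hd : d ∣ Module.finrank F E) :
    (Nat.card {w : E // minimalPeriod (powCardPow F d) w = Module.finrank F E / d ∧
      ¬ IsNormalElement (subfieldOfDegree F E d) w} : ℤ) =
      ∑ a ∈ (Module.finrank F E / d).divisors,
        ArithmeticFunction.moebius (Module.finrank F E / (d * a)) * (Nat.card F : ℤ) ^ (d * a) -
      (polyPhi (subfieldOfDegree F E d) (Module.finrank F E / d) : ℤ) := by
  classical
  have := Fintype.ofFinite E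
  have := Fintype.ofFinite (subfieldOfDegree F E d)
  have h := card_isNormalElement (E := E) (subfieldOfDegree F E d)
  rw [finrank_subfieldOfDegree hd] at h
  rw [← natCard_minimalPeriod_eq hd, ← h]
  simp_rw [Nat.card_eq_fintype_card (α := {x : E // _}), Fintype.card_subtype]
  have hsub : (Finset.univ.filter fun w : E => IsNormalElement (subfieldOfDegree F E d) w) ⊆
      Finset.univ.filter fun w : E =>
        minimalPeriod (powCardPow F d) w = Module.finrank F E / d :=
    Finset.monotone_filter_right _ fun w _ hw => hw.minimalPeriod_eq hd
  rw [← Nat.cast_sub (Finset.card_le_card hsub), ← Finset.card_sdiff_of_subset hsub]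
  congr 2
  ext w
  simp

/-- An empty set would impose no condition, making 0 completely normal. -/
lemma IsEssential.nonempty {D : Finset ℕ} (hD : IsEssential F E D) : D.Nonempty := by
  rw [Finset.nonempty_iff_ne_empty]
  rintro rfl
  exact not_isCompletelyNormal_zero ((hD.2 0).2 (by simp))

/-- An element of degree n over F has full degree n/d over every F_{q^d}. If it is not completely
normal, essentiality gives a d in `D` where it is counted by the d-th term of U. -/
lemma card_sub_numCN_le {D : Finset ℕ} (hD : IsEssential F E D) :
    (Nat.card E : ℤ) - numCN F E ≤ boundU F E D +
      Nat.card {x : E // minimalPeriod (powCardPow F 1) x ≠ Module.finrank F E} := by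
  classical
  have := Fintype.ofFinite E
  have hU : boundU F E D = ((∑ d ∈ D,
      Nat.card {w : E // minimalPeriod (powCardPow F d) w = Module.finrank F E / d ∧
      ¬ IsNormalElement (subfieldOfDegree F E d) w} : ℕ) : ℤ) := by
    rw [boundU, Nat.cast_sum]
    exact Finset.sum_congr rfl fun d hd => (natCard_not_isNormalElement (hD.1 d hd)).symm
  rw [hU, sub_le_iff_le_add, ← Nat.cast_add, ← Nat.cast_add, Nat.cast_le, numCN]
  simp_rw [Nat.card_eq_fintype_card, Fintype.card_subtype]
  rw [← Finset.card_univ]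
  refine (Finset.card_le_card ?_).trans ((Finset.card_union_le _ _).trans
    (Nat.add_le_add_right ((Finset.card_union_le _ _).trans
      (Nat.add_le_add_right (Finset.card_biUnion_le (s := D)) _)) _))
  intro w _
  simp only [Finset.mem_union, Finset.mem_biUnion, Finset.mem_filter, Finset.mem_univ, true_and]
  by_cases hw : IsCompletelyNormal F w
  · exact Or.inr hw
  by_cases hp : minimalPeriod (powCardPow F 1) w = Module.finrank F E
  · rw [hD.2] at hw
    push Not at hw
    obtain ⟨d, hd, hwd⟩ := hw
    exact Or.inl (Or.inl ⟨d, hd, minimalPeriod_powCardPow_of_one (hD.1 d hd) hp, hwd⟩)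
  · exact Or.inl (Or.inr hp)

end Counting

/-! ### Combining the estimates. -/

section Main

open Classical in
/-- The sum over the units of the indicator of a set avoiding zero is the cardinality of the set. -/
lemma sum_units_boole {E : Type*} [Field E] [Fintype E] (P : E → Prop) (h0 : ¬ P 0) :
    ∑ u : Eˣ, (if P u then (1 : ℂ) else 0) = Nat.card {w : E // P w} := by
  rw [Finset.sum_boole, Nat.card_eq_fintype_card, Fintype.card_subtype,
    ← Finset.card_map ⟨((↑) : Eˣ → E), Units.val_injective⟩]
  congr 2
  ext w
  simp only [Finset.mem_map, Finset.mem_filter, Finset.mem_univ, true_and,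
    Function.Embedding.coeFn_mk]
  constructor
  · rintro ⟨u, hu, rfl⟩
    exact hu
  · intro hw
    have : w ≠ 0 := by rintro rfl; exact h0 hw
    exact ⟨Units.mk0 w this, hw, rfl⟩

lemma sqrt_natCard_eq_rpow (F E : Type*) [Field F] [Field E] [Finite E] [Algebra F E] : √(Nat.card E) =
    (Nat.card F : ℝ) ^ ((Module.finrank F E : ℝ) / 2) := by
  rw [Real.sqrt_eq_rpow, natCard_eq_pow_finrank F E, Nat.cast_pow, ← Real.rpow_natCast_mul
    (by positivity), mul_one_div]

variable {F E : Type*} [Field F] [Finite F] [Field E] [Finite E] [Algebra F E]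

lemma finrank_div_ne_zero {d : ℕ} (hd : d ∣ Module.finrank F E) : Module.finrank F E / d ≠ 0 := by
  rw [← finrank_subfieldOfDegree hd]
  exact finrank_ne_zero' _ _

lemma bigOmega_eq_card {d : ℕ} (hd : d ∣ Module.finrank F E) : bigOmega F E d =
    (irredDivisors (subfieldOfDegree F E d) (Module.finrank F E / d)).card :=
  numIrredDivisors_eq_card (finrank_div_ne_zero hd)

/-- The p-free part gives a squarefree polynomial with the same irreducible divisors as x^{n/d} - 1;
so Θ_d is the mean of the normality indicator. -/
lemma bigTheta_eq_irredDensity {d : ℕ} (hd : d ∣ Module.finrank F E) : bigTheta F E d =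
    irredDensity (subfieldOfDegree F E d) (Module.finrank F E / d) := by
  have hm := finrank_div_ne_zero hd
  have hp : (ringChar F).Prime := CharP.char_is_prime F (ringChar F)
  have : Fact (ringChar F).Prime := ⟨hp⟩
  have : CharP (subfieldOfDegree F E d) (ringChar F) :=
    charP_of_injective_algebraMap (algebraMap F _).injective _
  have hm' : ((ordCompl[ringChar F] (Module.finrank F E / d) : ℕ) : subfieldOfDegree F E d) ≠ 0 := by
    rw [Ne, CharP.cast_eq_zero_iff (subfieldOfDegree F E d) (ringChar F)]
    exact Nat.not_dvd_ordCompl hp hm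
  have h := polyPhi_div_eq_irredDensity hm'
  rw [natCard_subfieldOfDegree hd, Nat.cast_pow, ← pow_mul] at h
  rw [bigTheta, h, irredDensity, irredDivisors_ordCompl _ hm, irredDensity]

lemma bigTheta_lt_one {d : ℕ} (hd : d ∣ Module.finrank F E) : bigTheta F E d < 1 := by
  rw [bigTheta_eq_irredDensity hd]
  exact irredDensity_lt_one (finrank_div_ne_zero hd)

lemma bigTheta_nonneg {d : ℕ} (hd : d ∣ Module.finrank F E) : 0 ≤ bigTheta F E d := by
  rw [bigTheta_eq_irredDensity hd]
  exact irredDensity_nonneg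

lemma bigOmega_pos {d : ℕ} (hd : d ∣ Module.finrank F E) : 0 < bigOmega F E d := by
  rw [bigOmega_eq_card hd]
  exact card_irredDivisors_pos (finrank_div_ne_zero hd)

open Classical in
lemma hasWienerBound_isCompletelyNormal [Fintype E] {D : Finset ℕ} (hD : IsEssential F E D) :
    HasWienerBound (fun w : E => if IsCompletelyNormal F w then 1 else 0)
      (∏ d ∈ D, (bigTheta F E d * (2 : ℝ) ^ bigOmega F E d)) := by
  have h := HasWienerBound.prod (A := E) D
    (f := fun d w => if IsNormalElement (subfieldOfDegree F E d) w then 1 else 0)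
    (C := fun d => bigTheta F E d * (2 : ℝ) ^ bigOmega F E d) (fun d hd => by
      have hd' := hD.1 d hd
      have := Fintype.ofFinite (subfieldOfDegree F E d)
      have h := hasWienerBound_isNormalElement (subfieldOfDegree F E d) E
      rwa [finrank_subfieldOfDegree hd', ← bigTheta_eq_irredDensity hd',
        ← bigOmega_eq_card hd'] at h)
  refine h.congr fun w => ?_
  rw [Finset.prod_apply, hD.2]
  split_ifs with hw
  · exact Finset.prod_eq_one fun d hd => if_pos (hw d hd)
  · push Not at hw
    obtain ⟨d, hd, hw⟩ := hw
    exact Finset.prod_eq_zero hd (if_neg hw)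

lemma numPCN_pos {D : Finset ℕ} (hD : IsEssential F E D)
    (h : √(Nat.card E) * ((2 : ℝ) ^ (Nat.card Eˣ).primeFactors.card - 1) *
      ∏ d ∈ D, (bigTheta F E d * (2 : ℝ) ^ bigOmega F E d) < numCN F E) : 0 < numPCN F E := by
  classical
  have := Fintype.ofFinite E
  have key := norm_sum_primitive_mul_sub_le (hasWienerBound_isCompletelyNormal hD)
  have h1 : ∑ u : Eˣ, (if IsPrimitiveElement (u : E) then (1 : ℂ) else 0) *
      (if IsCompletelyNormal F (u : E) then 1 else 0) = numPCN F E := by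
    rw [numPCN, ← sum_units_boole (fun w : E => IsPrimitiveElement w ∧ IsCompletelyNormal F w)
      (fun h => not_isCompletelyNormal_zero h.2)]
    refine Finset.sum_congr rfl fun u _ => ?_
    by_cases h1 : IsPrimitiveElement (u : E) <;>
      by_cases h2 : IsCompletelyNormal F (u : E) <;> simp [h1, h2]
  rw [h1, sum_units_boole _ not_isCompletelyNormal_zero, ← numCN] at key
  -- With no primitive completely normal element, only θ CN remains on the left; the positive
  -- density θ cancels.
  by_contra h0
  rw [Nat.eq_zero_of_not_pos h0, Nat.cast_zero, zero_sub, norm_neg, norm_mul, Complex.norm_real,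
    Real.norm_of_nonneg primitiveDensity_pos.le, Complex.norm_natCast, mul_assoc] at key
  have := le_of_mul_le_mul_left key primitiveDensity_pos
  rw [Nat.card_eq_fintype_card (α := E)] at h
  refine absurd h (not_lt.2 (this.trans_eq ?_))
  ring

lemma numPCN_pos_of_boundU {D : Finset ℕ} (hD : IsEssential F E D)
    (h : √(Nat.card E) * (2 : ℝ) ^ (Nat.card Eˣ).primeFactors.card *
      2 ^ (∑ d ∈ D, bigOmega F E d) ≤ (Nat.card E : ℝ) - (boundU F E D : ℝ)) :
    0 < numPCN F E := by
  refine numPCN_pos hD ?_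
  have hle : (Nat.card E : ℝ) - numCN F E ≤ boundU F E D + Nat.card {x : E //
      Function.minimalPeriod (powCardPow F 1) x ≠ Module.finrank F E} := by
    exact_mod_cast card_sub_numCN_le hD
  have hsqrt : (Nat.card F : ℝ) ^ (Module.finrank F E / 2) ≤ √(Nat.card E) := by
    refine Real.le_sqrt_of_sq_le ?_
    rw [← pow_mul, natCard_eq_pow_finrank F E, Nat.cast_pow]
    exact pow_le_pow_right₀ (by exact_mod_cast Nat.one_le_iff_ne_zero.2 Nat.card_pos.ne')
      (Nat.div_mul_le_self _ _)
  have hlt : (Nat.card {x : E //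
      Function.minimalPeriod (powCardPow F 1) x ≠ Module.finrank F E} : ℝ) <
        2 * √(Nat.card E) := by
    have : (Nat.card {x : E //
      Function.minimalPeriod (powCardPow F 1) x ≠ Module.finrank F E} : ℝ) <
        2 * (Nat.card F : ℝ) ^ (Module.finrank F E / 2) := by
      exact_mod_cast natCard_minimalPeriod_ne_lt (F := F) (E := E)
    linarith
  have hprod : ∏ d ∈ D, (bigTheta F E d * (2 : ℝ) ^ bigOmega F E d) ≤
      2 ^ (∑ d ∈ D, bigOmega F E d) := by
    rw [← Finset.prod_pow_eq_pow_sum]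
    exact Finset.prod_le_prod
      (fun d hd => mul_nonneg (bigTheta_nonneg (hD.1 d hd)) (by positivity))
      fun d hd => mul_le_of_le_one_left (by positivity) (bigTheta_lt_one (hD.1 d hd)).le
  -- Replacing 2^ω by 2^ω - 1 frees q^{n/2} 2^{ΣΩ_d}; since `D` is nonempty and every Ω_d is
  -- positive, this absorbs the 2 q^{n/2} from proper subfields.
  have h2 : (2 : ℝ) ≤ 2 ^ (∑ d ∈ D, bigOmega F E d) := by
    obtain ⟨d, hd⟩ := hD.nonempty
    exact le_self_pow₀ one_le_two ((bigOmega_pos (hD.1 d hd)).trans_le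
      (Finset.single_le_sum (f := bigOmega F E) (fun _ _ => Nat.zero_le _) hd)).ne'
  have hω : (0 : ℝ) ≤ √(Nat.card E) * ((2 : ℝ) ^ (Nat.card Eˣ).primeFactors.card - 1) :=
    mul_nonneg (Real.sqrt_nonneg _) (sub_nonneg.2 (one_le_pow₀ one_le_two))
  have h3 := mul_le_mul_of_nonneg_left hprod hω
  have h4 := mul_le_mul_of_nonneg_left h2 (Real.sqrt_nonneg (Nat.card E))
  linarith

end Main

end

theorem proposition3p2p6 {F E : Type*} [Field F] [Finite F] [Field E] [Finite E] [Algebra F E]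
    (q n ω : ℕ) (hq : q = Nat.card F) (hn : n = Module.finrank F E)
    (hω : ω = (q ^ n - 1).primeFactors.card) :
    (∀ D : Finset ℕ, IsEssential F E D →
      (numCN F E : ℝ) > (q : ℝ) ^ ((n : ℝ) / 2) * ((2 : ℝ) ^ ω - 1) *
          ∏ d ∈ D, (bigTheta F E d * (2 : ℝ) ^ bigOmega F E d) →
      0 < numPCN F E) ∧
    (∀ D : Finset ℕ, IsEssential F E D → ∀ d ∈ D, bigTheta F E d < 1) ∧
    (∀ D : Finset ℕ, IsEssential F E D →
      (q : ℝ) ^ n - (boundU F E D : ℝ) ≥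
          (q : ℝ) ^ ((n : ℝ) / 2) * (2 : ℝ) ^ ω * (2 : ℝ) ^ (∑ d ∈ D, bigOmega F E d) →
      0 < numPCN F E) ∧
    (2 : ℝ) ^ ω ≤ 4514.7 * (q : ℝ) ^ ((n : ℝ) / 8) ∧
    (∀ D : Finset ℕ, IsEssential F E D →
      (q : ℝ) ^ n - (boundU F E D : ℝ) ≥
          4514.7 * (q : ℝ) ^ (5 * (n : ℝ) / 8) * (2 : ℝ) ^ (∑ d ∈ D, bigOmega F E d) →
      0 < numPCN F E) := by
  subst hq hn
  have hE := natCard_eq_pow_finrank F E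
  have hω' : ω = (Nat.card Eˣ).primeFactors.card := by rw [hω, ← hE, Nat.card_units]
  have hbound : (2 : ℝ) ^ ω ≤ 4514.7 * (Nat.card F : ℝ) ^ ((Module.finrank F E : ℝ) / 8) :=
    hω ▸ two_pow_card_primeFactors_le Finite.one_lt_card (finrank_ne_zero' F E)
  have hpart : ∀ D : Finset ℕ, IsEssential F E D →
      (Nat.card F : ℝ) ^ Module.finrank F E - (boundU F E D : ℝ) ≥
          (Nat.card F : ℝ) ^ ((Module.finrank F E : ℝ) / 2) * (2 : ℝ) ^ ω *
            (2 : ℝ) ^ (∑ d ∈ D, bigOmega F E d) →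
      0 < numPCN F E := by
    intro D hD h
    refine numPCN_pos_of_boundU hD ?_
    rw [sqrt_natCard_eq_rpow F E, ← hω', hE, Nat.cast_pow]
    exact h
  refine ⟨fun D hD h => numPCN_pos hD ?_, fun D hD d hd => bigTheta_lt_one (hD.1 d hd), hpart,
    hbound, fun D hD h => hpart D hD (h.le.trans' ?_)⟩
  · rw [sqrt_natCard_eq_rpow F E, ← hω']
    exact h
  · refine mul_le_mul_of_nonneg_right ?_ (by positivity)
    calc _ ≤ (Nat.card F : ℝ) ^ ((Module.finrank F E : ℝ) / 2) *
          (4514.7 * (Nat.card F : ℝ) ^ ((Module.finrank F E : ℝ) / 8)) :=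
          mul_le_mul_of_nonneg_left hbound (by positivity)
      _ = _ := by
          rw [mul_left_comm, ← Real.rpow_add (Nat.cast_pos.2 Nat.card_pos)]
          congr 2
          ring
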